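/- Theorem 2.3 (Hurewicz Type Formula). A metric space $X$ has asymptotic dimension $\le n$ if for every $d>0$ there are a number $R$ and families $\mathcal U_0,\dots,\mathcal U_n$ of subsets of $X$ which together cover $X$, such that every member of every $\mathcal U_i$ has diameter at most $R$, and $d(x,y)>d$ whenever $x\in U$, $y\in V$ for distinct members $U,V$ of the same $\mathcal U_i$; $\operatorname{asdim}X\in\{0,1,2,\dots,\infty\}$ is the least such $n$, or $\infty$ if there is none. For a finitely generated group $F$, let $\operatorname{asdim}F$ be the asymptotic dimension of $F$ with the word metric of a finite generating set (it does not depend on the generating set). For an arbitrary group $G$ put $$\operatorname{asdim}G=\sup\{\operatorname{asdim}F \mid F\subset G\text{ a finitely generated subgroup}\}.$$ Then, for any homomorphism $\varphi\colon G\to H$ of arbitrary groups with kernel $K$, $$\operatorname{asdim}G\le\operatorname{asdim}H+\operatorname{asdim}K.$$ -/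

import Mathlib

/-- A family of subsets is `d`-disjoint if points of two different members are at distance
greater than `d`. -/
def DisjointFamily {X : Type*} [MetricSpace X] (d : ℝ) (𝒰 : Set (Set X)) : Prop :=
  ∀ U ∈ 𝒰, ∀ V ∈ 𝒰, U ≠ V → ∀ x ∈ U, ∀ y ∈ V, d < dist x y

/-- A family of subsets is `R`-bounded if every member has diameter at most `R`. -/
def BoundedFamily {X : Type*} [MetricSpace X] (R : ℝ) (𝒰 : Set (Set X)) : Prop :=
  ∀ U ∈ 𝒰, ∀ x ∈ U, ∀ y ∈ U, dist x y ≤ R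

/-- The metric space `X` has asymptotic dimension at most `n`: for every `d > 0` there are
`n + 1` families, each `d`-disjoint and all `R`-bounded for one `R`, which together cover `X`. -/
def AsdimLE (X : Type*) [MetricSpace X] (n : ℕ) : Prop :=
  ∀ d : ℝ, 0 < d → ∃ (R : ℝ) (𝒰 : Fin (n + 1) → Set (Set X)),
    (∀ i, DisjointFamily d (𝒰 i)) ∧ (∀ i, BoundedFamily R (𝒰 i)) ∧
      ∀ x : X, ∃ i, ∃ U ∈ 𝒰 i, x ∈ U

/-- Asymptotic dimension of a metric space: the least `n` with `AsdimLE X n`, and `⊤` if there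
is none. -/
noncomputable def metricAsdim (X : Type*) [MetricSpace X] : ℕ∞ :=
  ⨅ (n : ℕ) (_ : AsdimLE X n), (n : ℕ∞)

/-- Word length of `g` with respect to `S`: the least length of a word in the letters `s`, `s⁻¹`
(`s ∈ S`) that represents `g`. -/
noncomputable def wordLength {G : Type*} [Group G] (S : Set G) (g : G) : ℕ :=
  sInf {n : ℕ | ∃ l : List G, (∀ s ∈ l, s ∈ S ∨ s⁻¹ ∈ S) ∧ l.prod = g ∧ l.length = n}

lemma exists_word {G : Type*} [Group G] {S : Set G} (hS : Subgroup.closure S = ⊤) (g : G) :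
    ∃ l : List G, (∀ s ∈ l, s ∈ S ∨ s⁻¹ ∈ S) ∧ l.prod = g ∧ l.length = wordLength S g := by
  have hg : g ∈ Subgroup.closure S := by rw [hS]; trivial
  rw [← Subgroup.mem_toSubmonoid, Subgroup.closure_toSubmonoid] at hg
  obtain ⟨l, hl, hp⟩ := Submonoid.exists_list_of_mem_closure hg
  exact Nat.sInf_mem (s := {n : ℕ | ∃ l : List G, (∀ s ∈ l, s ∈ S ∨ s⁻¹ ∈ S) ∧ l.prod = g ∧
    l.length = n}) ⟨l.length, l, hl, hp, rfl⟩

lemma wordLength_le {G : Type*} [Group G] {S : Set G} (l : List G)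
    (hl : ∀ s ∈ l, s ∈ S ∨ s⁻¹ ∈ S) : wordLength S l.prod ≤ l.length :=
  Nat.sInf_le ⟨l, hl, rfl, rfl⟩

lemma wordLength_one {G : Type*} [Group G] (S : Set G) : wordLength S (1 : G) = 0 := by
  simpa using wordLength_le (S := S) [] (by simp)

lemma eq_one_of_wordLength {G : Type*} [Group G] {S : Set G} (hS : Subgroup.closure S = ⊤)
    {g : G} (h : wordLength S g = 0) : g = 1 := by
  obtain ⟨l, -, hp, hn⟩ := exists_word hS g
  rw [h, List.length_eq_zero_iff] at hn
  simpa [hn] using hp.symm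

lemma wordLength_mul_le {G : Type*} [Group G] {S : Set G} (hS : Subgroup.closure S = ⊤)
    (g h : G) : wordLength S (g * h) ≤ wordLength S g + wordLength S h := by
  obtain ⟨l, hl, hp, hn⟩ := exists_word hS g
  obtain ⟨l', hl', hp', hn'⟩ := exists_word hS h
  have := wordLength_le (S := S) (l ++ l') (by
    intro s hs
    rcases List.mem_append.1 hs with hs | hs
    exacts [hl s hs, hl' s hs])
  simpa [hp, hp', hn, hn'] using this

lemma wordLength_inv_le {G : Type*} [Group G] {S : Set G} (hS : Subgroup.closure S = ⊤)
    (g : G) : wordLength S g⁻¹ ≤ wordLength S g := by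
  obtain ⟨l, hl, hp, hn⟩ := exists_word hS g
  have := wordLength_le (S := S) (l.map (·⁻¹)).reverse (by
    intro s hs
    simp only [List.mem_reverse, List.mem_map] at hs
    obtain ⟨t, ht, rfl⟩ := hs
    simpa using (hl t ht).symm)
  rw [← List.prod_inv_reverse, hp] at this
  simpa [hn] using this

/-- The left invariant word metric `d(x, y) = ‖x⁻¹ y‖` of a generating set. -/
noncomputable abbrev wordMetric {G : Type*} [Group G] (S : Set G)
    (hS : Subgroup.closure S = ⊤) : MetricSpace G where
  dist x y := (wordLength S (x⁻¹ * y) : ℝ)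
  dist_self x := by simp [wordLength_one]
  dist_comm x y := by
    have h1 := wordLength_inv_le hS (x⁻¹ * y)
    have h2 := wordLength_inv_le hS (y⁻¹ * x)
    simp only [mul_inv_rev, inv_inv] at h1 h2
    exact_mod_cast le_antisymm h2 h1
  dist_triangle x y z := by
    have h := wordLength_mul_le hS (x⁻¹ * y) (y⁻¹ * z)
    simp only [mul_assoc, mul_inv_cancel_left] at h
    exact_mod_cast h
  eq_of_dist_eq_zero {x y} h := by
    have h' : x⁻¹ * y = 1 := eq_one_of_wordLength hS (by exact_mod_cast h)
    exact inv_mul_eq_one.1 h'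

/-- Asymptotic dimension of a finitely generated group: that of its word metric for a finite
generating set. The value does not depend on the chosen set, see `fgAsdim_eq`. -/
noncomputable def fgAsdim (G : Type*) [Group G] [h : Group.FG G] : ℕ∞ :=
  @metricAsdim G (wordMetric (h.out.choose : Set G) h.out.choose_spec)

/-- Asymptotic dimension of an arbitrary group: the supremum of the asymptotic dimensions of its
finitely generated subgroups. -/
noncomputable def groupAsdim (G : Type*) [Group G] : ℕ∞ :=
  ⨆ (F : Subgroup G) (_ : Group.FG F), fgAsdim F

/-- Two word metrics for finite generating sets are Lipschitz equivalent. -/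
lemma wordLength_le_mul {G : Type*} [Group G] (S : Finset G) {T : Set G}
    (hS : Subgroup.closure (S : Set G) = ⊤) (hT : Subgroup.closure T = ⊤) :
    ∃ C : ℕ, 0 < C ∧ ∀ g, wordLength T g ≤ C * wordLength (S : Set G) g := by
  refine ⟨S.sup (wordLength T) + 1, by omega, fun g => ?_⟩
  obtain ⟨l, hl, hp, hn⟩ := exists_word hS g
  rw [← hn, ← hp]
  clear hn hp
  induction l with
  | nil => simp [wordLength_one]
  | cons a l ih =>
    have h1 := wordLength_mul_le hT a l.prod
    have h2 := ih (fun s hs => hl s (List.mem_cons_of_mem _ hs))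
    have h3 : wordLength T a ≤ S.sup (wordLength T) := by
      rcases hl a List.mem_cons_self with h | h
      · exact Finset.le_sup (f := wordLength T) (by simpa using h)
      · have := wordLength_inv_le hT a⁻¹
        rw [inv_inv] at this
        exact this.trans (Finset.le_sup (f := wordLength T) (by simpa using h))
    rw [List.prod_cons, List.length_cons]
    nlinarith

lemma metricAsdim_wordMetric_le {G : Type*} [Group G] (S T : Finset G)
    (hS : Subgroup.closure (S : Set G) = ⊤) (hT : Subgroup.closure (T : Set G) = ⊤) :
    @metricAsdim G (wordMetric (S : Set G) hS) ≤ @metricAsdim G (wordMetric (T : Set G) hT) := by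
  obtain ⟨C, hC, hST⟩ := wordLength_le_mul S hS hT
  obtain ⟨D, -, hTS⟩ := wordLength_le_mul T hT hS
  refine le_iInf₂ fun n hn => iInf₂_le n ?_
  intro d hd
  obtain ⟨R, 𝒰, h1, h2, h3⟩ := hn (C * d) (by positivity)
  refine ⟨D * R, 𝒰, fun i U hU V hV hne x hx y hy => ?_, fun i U hU x hx y hy => ?_, h3⟩
  · have h := h1 i U hU V hV hne x hx y hy
    have h' : (wordLength (T : Set G) (x⁻¹ * y) : ℝ) ≤ C * wordLength (S : Set G) (x⁻¹ * y) := by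
      exact_mod_cast hST (x⁻¹ * y)
    exact lt_of_mul_lt_mul_left (lt_of_lt_of_le h h') (by positivity)
  · have h := h2 i U hU x hx y hy
    have h' : (wordLength (S : Set G) (x⁻¹ * y) : ℝ) ≤ D * wordLength (T : Set G) (x⁻¹ * y) := by
      exact_mod_cast hTS (x⁻¹ * y)
    exact h'.trans (mul_le_mul_of_nonneg_left h (by positivity))

/-- Every finite generating set computes the asymptotic dimension of a finitely generated
group. -/
lemma fgAsdim_eq {G : Type*} [Group G] [Group.FG G] (S : Finset G)
    (hS : Subgroup.closure (S : Set G) = ⊤) :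
    fgAsdim G = @metricAsdim G (wordMetric (S : Set G) hS) :=
  le_antisymm (metricAsdim_wordMetric_le _ _ _ _) (metricAsdim_wordMetric_le _ _ _ _)

/-!
Asymptotic dimension of a group only depends on which subsets are finite. A finite set `E ⊆ G` is a
scale, an `E`-chain moves by right multiplication with elements of `E`, and `CoarseDimLE G n` asks
that `G` be covered by `n + 1` sets in each of which the `E`-chains have displacements `x⁻¹ * y` in
one finite set. For every group this is equivalent to `groupAsdim G ≤ n`
(`CoarseDimLE.groupAsdim_le`, `CoarseDimLE.of_groupAsdim_le`): with `F` the subgroup generated by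
`E`, no `E`-chain leaves a left coset of `F`, so a cover of `F` is copied to all its cosets.

Now let `H` have dimension at most `m` and `K = ker φ` dimension at most `n`. Kolmogorov's trick
(`CoarseDimLE.exists_cover_multiplicity`) covers `H` by `m + n + 1` sets `Y i` such that every
point lies in at least `n + 1` of them, and chains of `Y i` at the scale `φ(E)` have displacements
in a finite set `B`. For `h : H` choose `n + 1` indices `i` with `h ∈ Y i`, decompose the fibre
`φ⁻¹(h)`, a coset of `K`, into `n + 1` pieces, and put one piece into each `X i` with `i` a chosen
index. These `X i` cover `G`, and an `E`-chain in `X i` meets fibres over points of `H` that differ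
by elements of `B⁻¹ * B` only. Colour `H` by finitely many colours so that such points have
different colours (`exists_coloring`). The scale of the decomposition of a fibre is allowed to
depend on the colour, and a chain meets at most one fibre of each colour, in a single piece. Hence,
if the scales grow fast enough from one colour to the next, the chain has bounded displacement
(`ChainBounded.union`, `exists_scales_chainBounded_iUnion`).
-/

open scoped Pointwise

/-! ### Chains and coarse dimension -/

/-- `Chain E A x y`: there is a finite sequence of points of `A` from `x` to `y` in which each point
is followed by a right translate of it by an element of `E`. Chains are directed, since `E` need
not be closed under inverses. -/

inductive Chain {G : Type*} [Group G] (E : Finset G) (A : Set G) (x : G) : G → Prop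
  | refl (hx : x ∈ A) : Chain E A x x
  | tail {y z : G} (h : Chain E A x y) (hz : z ∈ A) (hyz : y⁻¹ * z ∈ E) : Chain E A x z

/-- All `E`-chains in `A` have their displacement in `D`; for symmetric `E` and finite `D` this says
that the `E`-components of `A` are uniformly bounded. -/
def ChainBounded {G : Type*} [Group G] (E : Finset G) (A : Set G) (D : Finset G) : Prop :=
  ∀ x y, Chain E A x y → x⁻¹ * y ∈ D

/-- Asymptotic dimension at most `n` for an arbitrary group, expressed without a metric: finite sets
replace both the scale and the bound on the components. -/
def CoarseDimLE (G : Type*) [Group G] (n : ℕ) : Prop :=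
  ∀ E : Finset G, ∃ (D : Finset G) (X : Fin (n + 1) → Set G),
    (∀ i, ChainBounded E (X i) D) ∧ ∀ g, ∃ i, g ∈ X i

namespace Chain

variable {G : Type*} [Group G] {E E' : Finset G} {A A' : Set G} {x y z : G}

lemma left_mem (h : Chain E A x y) : x ∈ A := by
  induction h with
  | refl hx => exact hx
  | tail _ _ _ ih => exact ih

lemma right_mem (h : Chain E A x y) : y ∈ A := by
  cases h <;> assumption

lemma trans (h : Chain E A x y) (h' : Chain E A y z) : Chain E A x z := by
  induction h' with
  | refl _ => exact h
  | tail _ hz hyz ih => exact ih.tail hz hyz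

lemma symm (hE : ∀ g ∈ E, g⁻¹ ∈ E) (h : Chain E A x y) : Chain E A y x := by
  induction h with
  | refl hx => exact .refl hx
  | tail h hz hyz ih =>
    exact ((refl hz).tail h.right_mem (by simpa using hE _ hyz)).trans ih

/-- A map that carries steps to steps and the first set into the second carries chains to
chains. -/
lemma map {G' : Type*} [Group G'] {E₁ : Finset G'} {A₁ : Set G'} (f : G → G')
    (hA : ∀ a ∈ A, f a ∈ A₁) (hE : ∀ a ∈ A, ∀ b ∈ A, a⁻¹ * b ∈ E → (f a)⁻¹ * f b ∈ E₁)
    (h : Chain E A x y) : Chain E₁ A₁ (f x) (f y) := by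
  induction h with
  | refl hx => exact .refl (hA _ hx)
  | tail h hz hyz ih => exact ih.tail (hA _ hz) (hE _ h.right_mem _ hz hyz)

lemma mono (hE : E ⊆ E') (hA : A ⊆ A') (h : Chain E A x y) : Chain E' A' x y :=
  h.map id (fun _ ha => hA ha) fun _ _ _ _ he => hE he

/-- A chain in `A` from `x` runs through the points of `A` reachable from `x` only. -/
lemma reachable (h : Chain E A x y) : Chain E {z | Chain E A x z} x y := by
  induction h with
  | refl hx => exact .refl (.refl hx)
  | tail h hz hyz ih => exact ih.tail (h.tail hz hyz) hyz

end Chain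

lemma ChainBounded.mono {G : Type*} [Group G] {E E' D D' : Finset G} {A A' : Set G}
    (h : ChainBounded E A D) (hE : E' ⊆ E) (hA : A' ⊆ A) (hD : D ⊆ D') :
    ChainBounded E' A' D' :=
  fun x y hxy => hD (h x y (hxy.mono hE hA))

lemma CoarseDimLE.subgroup {G : Type*} [Group G] {n : ℕ} (h : CoarseDimLE G n)
    (F : Subgroup G) : CoarseDimLE F n := by
  classical
  intro E
  obtain ⟨D, X, hD, hX⟩ := h (E.image (↑))
  refine ⟨D.preimage (↑) Subtype.val_injective.injOn, fun i => {g : F | (g : G) ∈ X i},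
    fun i x y hxy => ?_, fun g => hX g⟩
  rw [Finset.mem_preimage]
  refine hD i x y (hxy.map (fun g : F => (g : G)) (fun a ha => ha) fun a _ b _ hab => ?_)
  exact Finset.mem_image_of_mem (fun g : F => (g : G)) hab

/-! ### Word balls and the comparison with asymptotic dimension -/

lemma exists_finset_wordLength_le {G : Type*} [Group G] (S : Finset G)
    (hS : Subgroup.closure (S : Set G) = ⊤) (N : ℕ) :
    ∃ B : Finset G, ∀ g, g ∈ B ↔ wordLength (S : Set G) g ≤ N := by
  classical
  suffices h : ∃ B : Finset G, ∀ l : List G, (∀ s ∈ l, s ∈ (S : Set G) ∨ s⁻¹ ∈ (S : Set G)) →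
      l.length ≤ N → l.prod ∈ B by
    obtain ⟨B, hB⟩ := h
    refine ⟨B.filter fun g => wordLength (S : Set G) g ≤ N, fun g => ?_⟩
    rw [Finset.mem_filter, and_iff_right_iff_imp]
    intro hg
    obtain ⟨l, hl, rfl, hn⟩ := exists_word hS g
    exact hB l hl (hn ▸ hg)
  induction N with
  | zero =>
    refine ⟨{1}, fun l _ hl => ?_⟩
    simp [List.length_eq_zero_iff.1 (Nat.le_zero.1 hl)]
  | succ N ih =>
    obtain ⟨B, hB⟩ := ih
    refine ⟨insert 1 ((S ∪ S⁻¹) * B), fun l hl hn => ?_⟩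
    cases l with
    | nil => simp
    | cons a l =>
      rw [List.prod_cons]
      refine Finset.mem_insert_of_mem (Finset.mul_mem_mul ?_ ?_)
      · simpa using hl a List.mem_cons_self
      · exact hB l (fun s hs => hl s (List.mem_cons_of_mem _ hs)) (by simpa using hn)

lemma AsdimLE.mono {X : Type*} [MetricSpace X] {m n : ℕ} (h : AsdimLE X m) (hmn : m ≤ n) :
    AsdimLE X n := by
  intro d hd
  obtain ⟨R, 𝒰, h1, h2, h3⟩ := h d hd
  refine ⟨R, fun i => if hi : (i : ℕ) < m + 1 then 𝒰 ⟨i, hi⟩ else ∅, fun i => ?_, fun i => ?_,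
    fun x => ?_⟩
  · by_cases hi : (i : ℕ) < m + 1
    · simpa only [hi, dite_true] using h1 _
    · simp [hi, DisjointFamily]
  · by_cases hi : (i : ℕ) < m + 1
    · simpa only [hi, dite_true] using h2 _
    · simp [hi, BoundedFamily]
  · obtain ⟨i, hi⟩ := h3 x
    exact ⟨Fin.castLE (by omega) i, by simpa [Nat.le_of_lt_succ i.isLt] using hi⟩

lemma asdimLE_of_metricAsdim_le {X : Type*} [MetricSpace X] {n : ℕ}
    (h : metricAsdim X ≤ n) : AsdimLE X n := by
  by_contra hn
  have h' : ((n + 1 : ℕ) : ℕ∞) ≤ metricAsdim X := by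
    refine le_iInf₂ fun m hm => ?_
    by_contra hlt
    exact hn (hm.mono (by have := Nat.cast_lt.1 (not_le.1 hlt); omega))
  have := Nat.cast_le.1 (h'.trans h)
  omega

/-- The members of the families are the `E`-components of the covering sets, where `E` is the word
ball of radius `d`. -/
lemma CoarseDimLE.asdimLE {G : Type*} [Group G] {n : ℕ} (h : CoarseDimLE G n) (S : Finset G)
    (hS : Subgroup.closure (S : Set G) = ⊤) :
    @AsdimLE G (wordMetric (S : Set G) hS) n := by
  intro d hd
  obtain ⟨E, hE⟩ := exists_finset_wordLength_le S hS ⌊d⌋₊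
  have hEinv : ∀ g ∈ E, g⁻¹ ∈ E := fun g hg =>
    (hE _).2 ((wordLength_inv_le hS g).trans ((hE g).1 hg))
  obtain ⟨D, X, hD, hX⟩ := h E
  refine ⟨(D.sup (wordLength (S : Set G)) : ℕ), fun i => {U | ∃ x, U = {y | Chain E (X i) x y}},
    ?_, ?_, fun x => ?_⟩
  · rintro i _ ⟨x, rfl⟩ _ ⟨y, rfl⟩ hne a ha b hb
    by_contra hab
    have hab' : a⁻¹ * b ∈ E := (hE _).2 (Nat.le_floor (not_lt.1 hab))
    have hxy : Chain E (X i) x y :=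
      (Chain.tail ha (Chain.right_mem hb) hab').trans (Chain.symm hEinv hb)
    refine hne (Set.ext fun z => ⟨fun hz => (hxy.symm hEinv).trans hz, fun hz => hxy.trans hz⟩)
  · rintro i _ ⟨x, rfl⟩ a ha b hb
    have := hD i a b ((Chain.symm hEinv ha).trans hb)
    exact Nat.cast_le.2 (Finset.le_sup (f := wordLength (S : Set G)) this)
  · obtain ⟨i, hi⟩ := hX x
    exact ⟨i, _, ⟨x, rfl⟩, .refl hi⟩

lemma CoarseDimLE.groupAsdim_le {G : Type*} [Group G] {n : ℕ} (h : CoarseDimLE G n) :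
    groupAsdim G ≤ n :=
  iSup₂_le fun F _ => iInf₂_le n ((h.subgroup F).asdimLE _ _)

/-- Only the finitely generated subgroup `F` generated by the scale `E` matters: a cover of `F` is
translated to each left coset of `F`, and `E`-chains stay in one coset. -/
lemma CoarseDimLE.of_groupAsdim_le {G : Type*} [Group G] {n : ℕ} (h : groupAsdim G ≤ n) :
    CoarseDimLE G n := by
  classical
  intro E
  set F : Subgroup G := Subgroup.closure (E : Set G) with hF
  set S : Finset F := E.preimage (↑) Subtype.val_injective.injOn with hSdef
  have hS : Subgroup.closure (S : Set F) = ⊤ := by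
    rw [hSdef, Finset.coe_preimage]
    exact Subgroup.closure_closure_coe_preimage
  have hFG : Group.FG F := ⟨⟨S, hS⟩⟩
  have hle : fgAsdim F ≤ n :=
    (le_iSup₂ (f := fun (F : Subgroup G) (_ : Group.FG F) => fgAsdim F) F hFG).trans h
  rw [fgAsdim_eq S hS] at hle
  obtain ⟨R, 𝒰, h1, h2, h3⟩ :=
    @asdimLE_of_metricAsdim_le F (wordMetric (S : Set F) hS) n hle 1 one_pos
  obtain ⟨B, hB⟩ := exists_finset_wordLength_le S hS ⌊R⌋₊
  -- a representative of the left coset of `g`, and the position `f g` of `g` in that coset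
  let r : G → G := fun g => (QuotientGroup.mk g : G ⧸ F).out
  have hr : ∀ g, (r g)⁻¹ * g ∈ F := fun g => QuotientGroup.eq.1 (QuotientGroup.out_eq' _)
  let f : G → F := fun g => ⟨(r g)⁻¹ * g, hr g⟩
  have hf : ∀ a b, r a = r b → ((f a)⁻¹ * f b : F) = a⁻¹ * b := fun a b hab => by
    simp only [f, Subgroup.coe_mul, Subgroup.coe_inv, hab]
    group
  refine ⟨B.image (↑), fun i => {g | ∃ U ∈ 𝒰 i, f g ∈ U}, fun i x y hxy => ?_, fun g => h3 (f g)⟩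
  obtain ⟨U, hU, hxU⟩ := hxy.left_mem
  have key : r x = r y ∧ f y ∈ U := by
    induction hxy with
    | refl _ => exact ⟨rfl, hxU⟩
    | @tail y z h hz hyz ih =>
      have hyz' : r y = r z := congrArg Quotient.out
        (QuotientGroup.eq.2 (Subgroup.subset_closure (by exact_mod_cast hyz)))
      refine ⟨ih.1.trans hyz', ?_⟩
      obtain ⟨V, hV, hzV⟩ := hz
      suffices U = V from this ▸ hzV
      by_contra hne
      have hlt := h1 i U hU V hV hne _ ih.2 _ hzV
      have hmem : (f y)⁻¹ * f z ∈ S := by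
        rw [hSdef, Finset.mem_preimage, hf y z hyz']
        exact hyz
      have hle := wordLength_le (S := (S : Set F)) [(f y)⁻¹ * f z] (by simpa using Or.inl hmem)
      simp only [List.prod_singleton, List.length_singleton] at hle
      have hle' : (wordLength (S : Set F) ((f y)⁻¹ * f z) : ℝ) ≤ 1 := by exact_mod_cast hle
      exact absurd hlt (not_lt.2 hle')
  refine Finset.mem_image.2 ⟨(f x)⁻¹ * f y, (hB _).2 (Nat.le_floor ?_), hf x y key.1⟩
  exact h2 i U hU _ hxU _ key.2

/-! ### Covers of higher multiplicity -/

/-- A chain in the thickening of `A` by `E₁` is shadowed by a chain in `A` at the larger scale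
`E₁ * E * E₁⁻¹`. -/
lemma ChainBounded.thicken {G : Type*} [Group G] [DecidableEq G] {E E₁ D : Finset G} {A : Set G}
    (h : ChainBounded (E₁ * E * E₁⁻¹) A D) :
    ChainBounded E {x | ∃ a ∈ A, a⁻¹ * x ∈ E₁} (E₁⁻¹ * D * E₁) := by
  intro x y hxy
  obtain ⟨a, ha, hax⟩ := hxy.left_mem
  obtain ⟨b, hab, hby⟩ : ∃ b, Chain (E₁ * E * E₁⁻¹) A a b ∧ b⁻¹ * y ∈ E₁ := by
    induction hxy with
    | refl _ => exact ⟨a, .refl ha, hax⟩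
    | @tail y z _ hz hyz ih =>
      obtain ⟨b, hab, hby⟩ := ih
      obtain ⟨c, hc, hcz⟩ := hz
      refine ⟨c, hab.tail hc ?_, hcz⟩
      have := Finset.mul_mem_mul (Finset.mul_mem_mul hby hyz) (Finset.inv_mem_inv hcz)
      convert this using 1
      group
  have := Finset.mul_mem_mul (Finset.mul_mem_mul (Finset.inv_mem_inv hax) (h a b hab)) hby
  convert this using 1
  group

/-- Kolmogorov's trick: `n + 1 + k` sets can be chosen such that each point lies in at least `k + 1`
of them. To add a set, the old ones are thickened, and the new one consists of the points whose
multiplicity has not increased. -/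
lemma CoarseDimLE.exists_cover_multiplicity {G : Type*} [Group G] {n : ℕ} (h : CoarseDimLE G n)
    (k : ℕ) (E : Finset G) : ∃ (D : Finset G) (X : Fin (n + 1 + k) → Set G),
      (∀ i, ChainBounded E (X i) D) ∧
        ∀ g, ∃ I : Finset (Fin (n + 1 + k)), I.card = k + 1 ∧ ∀ i ∈ I, g ∈ X i := by
  classical
  induction k generalizing E with
  | zero =>
    obtain ⟨D, X, hD, hX⟩ := h E
    refine ⟨D, X, hD, fun g => ?_⟩
    obtain ⟨i, hi⟩ := hX g
    exact ⟨{i}, by simp, by simpa using hi⟩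
  | succ k ih =>
    set E₁ : Finset G := insert 1 E with hE₁
    have h1 : (1 : G) ∈ E₁ := Finset.mem_insert_self _ _
    obtain ⟨D, X, hD, hX⟩ := ih (E₁ * E * E₁⁻¹)
    let T : Fin (n + 1 + k) → Set G := fun i => {x | ∃ a ∈ X i, a⁻¹ * x ∈ E₁}
    have hXT : ∀ i, X i ⊆ T i := fun i x hx => ⟨x, hx, by simpa using h1⟩
    -- the points that still have multiplicity only `k + 1` after the thickening
    let L : Set G := {g | ¬ ∃ I : Finset (Fin (n + 1 + k)), I.card = k + 2 ∧ ∀ i ∈ I, g ∈ T i}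
    have hsub : E ⊆ E₁ * E * E₁⁻¹ := fun e he =>
      Finset.mem_mul.2 ⟨e, Finset.mem_mul.2 ⟨1, h1, e, he, one_mul e⟩, 1, by simpa using h1,
        mul_one e⟩
    have hL : ChainBounded E L D := by
      intro x y hxy
      obtain ⟨I, hI, hIx⟩ := hX x
      have hne : I.Nonempty := Finset.card_pos.1 (by omega)
      obtain ⟨i₀, hi₀⟩ := hne
      -- Along a chain in `L` the set of indices of the original cover that contain the point is
      -- constant: a step puts the next point into `T i` for all old and all new indices, and
      -- there can only be `k + 1` of these.
      have key : (∀ i ∈ I, y ∈ X i) ∧ Chain E (X i₀) x y := by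
        induction hxy with
        | refl _ => exact ⟨hIx, .refl (hIx _ hi₀)⟩
        | @tail y z _ hz hyz ih' =>
          obtain ⟨J, hJ, hJz⟩ := hX z
          have hIJ : ∀ i ∈ I ∪ J, z ∈ T i := fun i hi => by
            rcases Finset.mem_union.1 hi with hi | hi
            · exact ⟨y, ih'.1 i hi, Finset.mem_insert_of_mem hyz⟩
            · exact hXT i (hJz i hi)
          have hcard : (I ∪ J).card ≤ k + 1 := by
            by_contra hlt
            obtain ⟨I', hI', hcard'⟩ := Finset.exists_subset_card_eq (n := k + 2) (s := I ∪ J)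
              (by omega)
            exact hz ⟨I', hcard', fun i hi => hIJ i (hI' hi)⟩
          have hJI : J = I ∪ J :=
            Finset.eq_of_subset_of_card_le Finset.subset_union_right (by omega)
          have hz' : ∀ i ∈ I, z ∈ X i := fun i hi =>
            hJz i (hJI ▸ Finset.mem_union_left J hi)
          exact ⟨hz', ih'.2.tail (hz' _ hi₀) hyz⟩
      exact hD i₀ x y (key.2.mono hsub subset_rfl)
    refine ⟨D ∪ E₁⁻¹ * D * E₁, Fin.snoc (α := fun _ => Set G) T L, fun i => ?_, fun g => ?_⟩
    · refine Fin.lastCases ?_ (fun i => ?_) i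
      · rw [Fin.snoc_last]
        exact hL.mono subset_rfl subset_rfl Finset.subset_union_left
      · rw [Fin.snoc_castSucc]
        exact (hD i).thicken.mono subset_rfl subset_rfl Finset.subset_union_right
    · by_cases hg : g ∈ L
      · obtain ⟨I, hI, hIg⟩ := hX g
        refine ⟨insert (Fin.last _) (I.map Fin.castSuccEmb), ?_, fun i hi => ?_⟩
        · rw [Finset.card_insert_of_notMem, Finset.card_map, hI]
          simp [Fin.castSucc_ne_last]
        · rcases Finset.mem_insert.1 hi with rfl | hi
          · rwa [Fin.snoc_last]
          · obtain ⟨j, hj, rfl⟩ := Finset.mem_map.1 hi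
            rw [Fin.coe_castSuccEmb, Fin.snoc_castSucc]
            exact hXT j (hIg j hj)
      · obtain ⟨I, hI, hIg⟩ := not_not.1 hg
        refine ⟨I.map Fin.castSuccEmb, by rw [Finset.card_map, hI], fun i hi => ?_⟩
        obtain ⟨j, hj, rfl⟩ := Finset.mem_map.1 hi
        rw [Fin.coe_castSuccEmb, Fin.snoc_castSucc]
        exact hIg j hj

/-! ### Finite unions -/

/-- If `Q` is controlled at a scale that exceeds the size `D` of the chains of `P`, then `P ∪ Q` is
controlled: skipping the excursions of a chain into `P` leaves a chain in `Q` at the scale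
`E ∪ E * D * E`. -/
lemma ChainBounded.union {G : Type*} [Group G] [DecidableEq G] {E D F : Finset G} {P Q : Set G}
    (hP : ChainBounded E P D) (hQ : ChainBounded (E ∪ E * D * E) Q F) :
    ChainBounded E (P ∪ Q)
      (D ∪ insert 1 (D * E) * F * insert 1 (E * D)) := by
  intro x y hxy
  -- `q` and `q'` are the first and the last point of the chain in `Q`
  have key : Chain E P x y ∨ ∃ q q', x⁻¹ * q ∈ insert 1 (D * E) ∧
      Chain (E ∪ E * D * E) Q q q' ∧ (q' = y ∨ ∃ p, q'⁻¹ * p ∈ E ∧ Chain E P p y) := by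
    induction hxy with
    | refl hx =>
      rcases hx with hx | hx
      · exact .inl (.refl hx)
      · exact .inr ⟨x, x, by simp, .refl hx, .inl rfl⟩
    | @tail y z _ hz hyz ih =>
      rcases hz with hz | hz
      · rcases ih with ih | ⟨q, q', hq, hqq, rfl | ⟨p, hp, hpy⟩⟩
        · exact .inl (ih.tail hz hyz)
        · exact .inr ⟨q, q', hq, hqq, .inr ⟨z, hyz, .refl hz⟩⟩
        · exact .inr ⟨q, q', hq, hqq, .inr ⟨p, hp, hpy.tail hz hyz⟩⟩
      · rcases ih with ih | ⟨q, q', hq, hqq, rfl | ⟨p, hp, hpy⟩⟩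
        · refine .inr ⟨z, z, Finset.mem_insert_of_mem ?_, .refl hz, .inl rfl⟩
          have := Finset.mul_mem_mul (hP _ _ ih) hyz
          convert this using 1
          group
        · exact .inr ⟨q, z, hq, hqq.tail hz (Finset.mem_union_left _ hyz), .inl rfl⟩
        · refine .inr ⟨q, z, hq, hqq.tail hz (Finset.mem_union_right _ ?_), .inl rfl⟩
          have := Finset.mul_mem_mul (Finset.mul_mem_mul hp (hP _ _ hpy)) hyz
          convert this using 1
          group
  rcases key with h | ⟨q, q', hq, hqq, h⟩
  · exact Finset.mem_union_left _ (hP _ _ h)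
  · refine Finset.mem_union_right _ ?_
    have hy : q'⁻¹ * y ∈ insert 1 (E * D) := by
      rcases h with rfl | ⟨p, hp, hpy⟩
      · simp
      · refine Finset.mem_insert_of_mem ?_
        have := Finset.mul_mem_mul hp (hP _ _ hpy)
        convert this using 1
        group
    have := Finset.mul_mem_mul (Finset.mul_mem_mul hq (hQ _ _ hqq)) hy
    convert this using 1
    group

/-- For a given dependence `D` of the bound on the scale, there are scales `s 0, s 1, …` such that
`N` sets, the `c`-th of them controlled at the scale `s c` by `D (s c)`, have a controlled union.
Neither the scales nor the final bound depend on the sets. -/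
lemma exists_scales_chainBounded_iUnion {G : Type*} [Group G] (D : Finset G → Finset G) (N : ℕ)
    (E : Finset G) : ∃ (s : ℕ → Finset G) (F : Finset G), ∀ A : ℕ → Set G,
      (∀ c < N, ChainBounded (s c) (A c) (D (s c))) →
        ChainBounded E {x | ∃ c < N, x ∈ A c} F := by
  classical
  induction N generalizing E with
  | zero =>
    refine ⟨fun _ => ∅, ∅, fun A _ x y hxy => ?_⟩
    obtain ⟨c, hc, -⟩ := hxy.left_mem
    omega
  | succ N ih =>
    obtain ⟨s, F, hF⟩ := ih (E ∪ E * D E * E)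
    refine ⟨fun c => Nat.casesOn c E s, _, fun A hA =>
      ((hA 0 N.succ_pos).union (hF (fun c => A (c + 1)) fun c hc => hA (c + 1) (by omega))).mono
        subset_rfl ?_ subset_rfl⟩
    rintro x ⟨_ | c, hc, hx⟩
    · exact .inl hx
    · exact .inr ⟨c, by omega, hx⟩

/-! ### Colourings -/

/-- The Cayley graph of a finite set `B` has a colouring by finitely many colours. The colours are
chosen greedily along a well-ordering of the group. -/
lemma exists_coloring {H : Type*} [Group H] (B : Finset H) :
    ∃ (N : ℕ) (c : H → ℕ), (∀ h, c h < N) ∧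
      ∀ h h', h⁻¹ * h' ∈ B → c h = c h' → h = h' := by
  classical
  let r : H → H → Prop := WellOrderingRel
  have hwf : WellFounded r := WellOrderingRel.isWellOrder.wf
  let B' := B ∪ B⁻¹
  let c : H → ℕ := hwf.fix fun h c =>
    sInf {n | ∀ h' (hr : r h' h), h⁻¹ * h' ∈ B' → c h' hr ≠ n}
  have hc : ∀ h, c h = sInf {n | ∀ h', r h' h → h⁻¹ * h' ∈ B' → c h' ≠ n} := fun h =>
    hwf.fix_eq _ h
  have hex : ∀ h, ∃ n < B'.card + 1, ∀ h', r h' h → h⁻¹ * h' ∈ B' → c h' ≠ n := by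
    intro h
    obtain ⟨n, hn, hn'⟩ := Finset.exists_mem_notMem_of_card_lt_card
      (s := B'.image fun b => c (h * b)) (t := Finset.range (B'.card + 1))
      (by rw [Finset.card_range]; exact Nat.lt_succ_of_le Finset.card_image_le)
    refine ⟨n, Finset.mem_range.1 hn, fun h' _ hB' hcn => hn' ?_⟩
    exact Finset.mem_image.2 ⟨_, hB', by simpa using hcn⟩
  have hne : ∀ h h', r h' h → h⁻¹ * h' ∈ B' → c h' ≠ c h := by
    intro h h' hr hB'
    obtain ⟨n, -, hn⟩ := hex h
    rw [hc h]
    exact Nat.sInf_mem (s := {n | ∀ h', r h' h → h⁻¹ * h' ∈ B' → c h' ≠ n}) ⟨n, hn⟩ h' hr hB'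
  refine ⟨B'.card + 1, c, fun h => ?_, fun h h' hB hcc => ?_⟩
  · obtain ⟨n, hlt, hn⟩ := hex h
    rw [hc h]
    exact (Nat.sInf_le (s := {n | ∀ h', r h' h → h⁻¹ * h' ∈ B' → c h' ≠ n}) hn).trans_lt hlt
  · rcases trichotomous_of r h h' with hr | rfl | hr
    · refine absurd hcc (hne h' h hr (Finset.mem_union_right _ ?_))
      simpa using hB
    · rfl
    · exact absurd hcc.symm (hne h h' hr (Finset.mem_union_left _ hB))

/-! ### Extensions -/

/-- The Hurewicz type formula in terms of `CoarseDimLE`. -/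
theorem CoarseDimLE.of_hom {G : Type*} {H : Type*} [Group G] [Group H] (φ : G →* H) {m n : ℕ}
    (hH : CoarseDimLE H m) (hK : CoarseDimLE φ.ker n) : CoarseDimLE G (m + n) := by
  classical
  intro E
  obtain ⟨B, Y, hB, hY⟩ := hH.exists_cover_multiplicity n (E.image φ)
  obtain ⟨N, c, hcN, hc⟩ := exists_coloring (B⁻¹ * B)
  choose I hIcard hI using hY
  -- `σ h j` is the index of the set that receives the `j`-th piece of the fibre over `h`
  let σ : ∀ h, Fin (n + 1) → Fin (m + 1 + n) := fun h => (I h).orderEmbOfFin (hIcard h)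
  have hσY : ∀ h j, h ∈ Y (σ h j) := fun h j => hI h _ (Finset.orderEmbOfFin_mem _ _ _)
  have hσ : ∀ h, Function.Injective (σ h) := fun h => ((I h).orderEmbOfFin (hIcard h)).injective
  choose DK Z hDZ hZ using hK
  let t : Finset G → Finset φ.ker := fun s => s.preimage (↑) Subtype.val_injective.injOn
  obtain ⟨s, F, hF⟩ := exists_scales_chainBounded_iUnion
    (fun s => (DK (t s)).image ((↑) : φ.ker → G)) N E
  -- a base point in every coset of the kernel
  let b : G → G := fun g => Function.invFun φ (φ g)
  have hφb : ∀ g, φ (b g) = φ g := fun g => Function.invFun_eq ⟨g, rfl⟩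
  have hbker : ∀ g, (b g)⁻¹ * g ∈ φ.ker := fun g => by
    rw [MonoidHom.mem_ker, map_mul, map_inv, hφb, inv_mul_cancel]
  let κ : G → φ.ker := fun g => ⟨(b g)⁻¹ * g, hbker g⟩
  let X : Fin (m + 1 + n) → Set G := fun i =>
    {g | ∃ j, σ (φ g) j = i ∧ κ g ∈ Z (t (s (c (φ g)))) j}
  have hX : ∀ i, ChainBounded E (X i) F := by
    intro i x y hxy
    have hW : ∀ z, Chain E (X i) x z → (φ x)⁻¹ * φ z ∈ B := fun z hz => by
      refine hB i _ _ (hz.map φ ?_ fun a _ a' _ haa => ?_)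
      · rintro a ⟨j, rfl, -⟩
        exact hσY _ _
      · rw [← map_inv, ← map_mul]
        exact Finset.mem_image_of_mem φ haa
    -- The points of colour `k` reachable from `x` lie in one fibre, and there in one piece.
    let A : ℕ → Set G := fun k => {z | Chain E (X i) x z ∧ c (φ z) = k}
    have hA : ∀ k < N, ChainBounded (s k) (A k) ((DK (t (s k))).image ((↑) : φ.ker → G)) := by
      intro k _ u v huv
      obtain ⟨hu, hcu⟩ := huv.left_mem
      obtain ⟨j, hj, -⟩ := hu.right_mem
      have hfib : ∀ w ∈ A k, φ w = φ u := fun w hw => by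
        refine (hc _ _ ?_ (hcu.trans hw.2.symm)).symm
        have := Finset.mul_mem_mul (Finset.inv_mem_inv (hW _ hu)) (hW _ hw.1)
        convert this using 1
        group
      have hb : ∀ w ∈ A k, b w = b u := fun w hw => congrArg (Function.invFun φ) (hfib w hw)
      have hκ : ∀ w ∈ A k, ∀ w' ∈ A k, (((κ w)⁻¹ * κ w' : φ.ker) : G) = w⁻¹ * w' :=
        fun w hw w' hw' => by
          simp only [κ, Subgroup.coe_mul, Subgroup.coe_inv, hb w hw, hb w' hw']
          group
      have hch : Chain (t (s k)) (Z (t (s k)) j) (κ u) (κ v) := by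
        refine huv.map κ (fun w hw => ?_) fun w hw w' hw' hww => ?_
        · obtain ⟨j', hj', hwj⟩ := hw.1.right_mem
          rw [hfib w hw, ← hj] at hj'
          rw [hw.2, hσ _ hj'] at hwj
          exact hwj
        · rw [Finset.mem_preimage, hκ w hw w' hw']
          exact hww
      exact Finset.mem_image.2 ⟨_, hDZ _ j _ _ hch, hκ u huv.left_mem v huv.right_mem⟩
    exact hF A hA x y (hxy.reachable.mono subset_rfl fun z hz => ⟨_, hcN (φ z), hz, rfl⟩)
  have hmn : m + n + 1 = m + 1 + n := by omega
  refine ⟨F, fun i => X (Fin.cast hmn i), fun i => hX _, fun g => ?_⟩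
  obtain ⟨j, hj⟩ := hZ (t (s (c (φ g)))) (κ g)
  exact ⟨Fin.cast hmn.symm (σ (φ g) j), j, by simp, hj⟩

theorem theorem2p3 {G : Type*} {H : Type*} [Group G] [Group H] (φ : G →* H) :
    groupAsdim G ≤ groupAsdim H + groupAsdim φ.ker := by
  rcases eq_or_ne (groupAsdim H) ⊤ with hH | hH
  · simp [hH]
  rcases eq_or_ne (groupAsdim φ.ker) ⊤ with hK | hK
  · simp [hK]
  obtain ⟨m, hm⟩ := ENat.ne_top_iff_exists.1 hH
  obtain ⟨n, hn⟩ := ENat.ne_top_iff_exists.1 hK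
  rw [← hm, ← hn, ← Nat.cast_add]
  exact (CoarseDimLE.of_hom φ (.of_groupAsdim_le hm.ge) (.of_groupAsdim_le hn.ge)).groupAsdim_le
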